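/- Let $X=[0,1]\setminus\mathbb{Q}$, let $T:X\to X$, $T(x)=1/x \bmod 1$, be the Gauss map, and for $i_1,\dots,i_n\in\mathbb{N}=\{1,2,\dots\}$ let $I_{i_1\ldots i_n}\subset X$ be the set of points whose continued fraction expansion begins with $i_1,\dots,i_n$. For a probability vector $\mathbf{p}=(p_n)_{n\in\mathbb{N}}$ let $\mu_{\mathbf p}$ be the image, under the continued fraction map $(i_k)_k\mapsto[0;i_1,i_2,\dots]$, of the product measure on $\mathbb{N}^{\mathbb{N}}$ with marginals $\mathbf p$, and let $\dim\mu_{\mathbf p}=\inf\{\dim_H A: A \text{ Borel},\ \mu_{\mathbf p}(A)=1\}$. Put $\psi=|T'(z_1)|^{-1/4}$ with $z_1=[0;1,1,1,\dots]$, and fix $\epsilon>0$. Say that $\mathbf p$ is admissible if $p_n>0$ for all $n$, $(p_n)$ is decreasing (in the weak sense), $p_n=O(1/n^2)$ (with a constant that may depend on $\mathbf p$), $\dim\mu_{\mathbf p}>\frac34$, and either $p_1,p_2\ge\epsilon$ or $p_1>\psi$. A function $g:X\to\mathbb{R}$ is locally Hölder if there are $C>0$ and $0<\theta<1$ such that $|g(x)-g(y)|\le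 C\theta^n$ for all $n\ge1$ and all $x,y$ in a common cylinder $I_{i_1\ldots i_n}$; $\mathcal{H}$ is the space of bounded locally Hölder functions. Write $S_ng=\sum_{k=0}^{n-1}g\circ T^k$ and $P(g)=\lim_{n\to\infty}\frac1n\log\sum_{T^nx=x}e^{S_ng(x)}$. A measure $\mu$ on $X$ is a Gibbs measure for $g$ if there are $C>0$ and $P\in\mathbb{R}$ such that $C^{-1}e^{S_ng(x)-nP}\le\mu(I_{i_1\ldots i_n})\le Ce^{S_ng(x)-nP}$ for all $n\ge1$, all $i_1,\dots,i_n$ and all $x\in I_{i_1\ldots i_n}$. For admissible $\mathbf p$ and $t\in[0,1]$ let $\beta_{\mathbf p}(t)\in[0,1]$ be the solution of $P(g_{\mathbf p,t})=0$, where $g_{\mathbf p,t}(x)=-\beta_{\mathbf p}(t)\log|T'(x)|+t\log p_n$ for $x\in I_n$. Let $\mathcal{L}_{\mathbf p,t}w(x)=\sum_{Ty=x}e^{g_{\mathbf p,t}(y)}w(y)$, let $h_{\mathbf p,t}\in\mathcal{H}$ be the (up to scaling unique) positive fixed point of $\mathcal{L}_{\mathbf p,t}$, let $\mathcal{M}_{\mathbf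 p,t}w=h_{\mathbf p,t}^{-1}\mathcal{L}_{\mathbf p,t}(h_{\mathbf p,t}w)$, and let $\mu_{\mathbf p,t}$ be the $T$-invariant Gibbs probability measure for $g_{\mathbf p,t}$. For $f:X\to\mathbb{R}$ let $\|f\|_{0,1}=\sup_{x\ne y}\frac{|f(x)-f(y)|}{|x-y|}+\sup_x|f(x)|$. (By density, bounded Lipschitz functions on $X$ and Lipschitz functions on $[0,1]$ are the same, with the same norm.) Lemma. There are constants $c_4>0$ and $0<\rho<1$, depending at most on $\epsilon$, such that for all admissible $\mathbf p$, all $t\in[0,1]$, all $f:X\to\mathbb{R}$ with $\|f\|_{0,1}<\infty$ and $\int f\,d\mu_{\mathbf p,t}=0$, and all integers $n\ge0$, $$\|\mathcal{M}_{\mathbf p,t}^{\,n}f\|_{0,1}\le c_4\,\rho^n\,\|f\|_{0,1}.$$ -/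

import Mathlib

open MeasureTheory Filter Topology
open scoped ENNReal

noncomputable section

namespace GaussGap

/-! ### The Gauss map on `X = [0,1] \ ℚ` -/

/-- The phase space `X = [0,1] \ ℚ`, with the metric and Borel structure inherited from `ℝ`.
As `X` is dense in `[0,1]`, Lipschitz functions on `X` are exactly the restrictions of Lipschitz
functions on `[0,1]`, with the same Lipschitz constant and the same sup norm. -/
abbrev X : Type := {x : ℝ // x ∈ Set.Icc (0 : ℝ) 1 ∧ Irrational x}

/-- The real function `x ↦ 1/x mod 1`. -/
def gaussFun (x : ℝ) : ℝ := Int.fract (1 / x)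

theorem gaussFun_mem (x : X) :
    gaussFun x.1 ∈ Set.Icc (0 : ℝ) 1 ∧ Irrational (gaussFun x.1) := by
  refine ⟨⟨Int.fract_nonneg _, (Int.fract_lt_one _).le⟩, ?_⟩
  have h : Irrational (1 / x.1) := by
    rw [one_div]
    exact x.2.2.inv
  exact h.sub_intCast _

/-- The Gauss map `T : X → X`, `T x = 1/x mod 1`. -/
def T (x : X) : X := ⟨gaussFun x.1, gaussFun_mem x⟩

/-- `log |T'(x)|`. -/
def logDeriv (x : X) : ℝ := Real.log |deriv gaussFun x.1|

theorem digit_pos (x : X) : 0 < ⌊1 / x.1⌋₊ := by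
  have h0 : 0 < x.1 := lt_of_le_of_ne x.2.1.1 (fun h => x.2.2.ne_zero h.symm)
  exact Nat.floor_pos.2 ((one_le_div h0).2 x.2.1.2)

/-- The first continued fraction digit of `x`: the `n` with `1/(n+1) < x < 1/n`. -/
def digit (x : X) : ℕ+ := ⟨⌊1 / x.1⌋₊, digit_pos x⟩

/-- The cylinder `I_{i_1 … i_n}`: the points whose first `n` digits are `i_1, …, i_n`. -/
def cylinder {n : ℕ} (i : Fin n → ℕ+) : Set X := {x | ∀ k : Fin n, digit (T^[k] x) = i k}

/-- The Birkhoff sum `S_n g = g + g ∘ T + ⋯ + g ∘ T^{n-1}`. -/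
def birkhoff (g : X → ℝ) (n : ℕ) (x : X) : ℝ := ∑ k ∈ Finset.range n, g (T^[k] x)

/-! ### Function spaces -/

/-- The norm `‖f‖_{0,1} = sup_{x ≠ y} |f x - f y| / |x - y| + sup_x |f x|`, with value `∞` exactly
if `f` is unbounded or not Lipschitz. -/
def lipNorm (f : X → ℝ) : ℝ≥0∞ :=
  (⨆ (x : X) (y : X) (_ : x ≠ y), ENNReal.ofReal (|f x - f y| / |x.1 - y.1|)) +
    ⨆ x : X, ENNReal.ofReal |f x|

/-- `g` is locally Hölder: its variation over cylinders of length `n ≥ 1` is at most `C θ^n`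
for some `C > 0` and `0 < θ < 1`. -/
def LocallyHolder (g : X → ℝ) : Prop :=
  ∃ C > 0, ∃ θ : ℝ, 0 < θ ∧ θ < 1 ∧
    ∀ n : ℕ, 1 ≤ n → ∀ i : Fin n → ℕ+, ∀ x ∈ cylinder i, ∀ y ∈ cylinder i, |g x - g y| ≤ C * θ ^ n

/-- The space `𝓗` of bounded locally Hölder functions. -/
def BoundedLocallyHolder (g : X → ℝ) : Prop :=
  LocallyHolder g ∧ ∃ B : ℝ, ∀ x, |g x| ≤ B

/-! ### Thermodynamic formalism -/

/-- `P` is the topological pressure of `g`: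
`P = lim (1/n) log ∑_{T^n x = x} exp (S_n g x)`, in the extended reals. -/
def HasPressure (g : X → ℝ) (P : EReal) : Prop :=
  Tendsto (fun n : ℕ =>
      ENNReal.log (∑' x : {x : X // T^[n] x = x}, ENNReal.ofReal (Real.exp (birkhoff g n x.1)))
        / (n : EReal))
    atTop (𝓝 P)

/-- `μ` is a Gibbs measure for `g`: up to a multiplicative constant, `μ(I_{i_1 … i_n})` is
`exp (S_n g x - n P)` for `x ∈ I_{i_1 … i_n}`. -/
def IsGibbs (g : X → ℝ) (μ : Measure X) : Prop :=
  ∃ C > 0, ∃ P : ℝ, ∀ n : ℕ, 1 ≤ n → ∀ i : Fin n → ℕ+, ∀ x ∈ cylinder i,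
    ENNReal.ofReal (C⁻¹ * Real.exp (birkhoff g n x - n * P)) ≤ μ (cylinder i) ∧
      μ (cylinder i) ≤ ENNReal.ofReal (C * Real.exp (birkhoff g n x - n * P))

/-- The transfer operator `(L_g w)(x) = ∑_{T y = x} exp (g y) w y`. -/
def transfer (g : X → ℝ) (w : X → ℝ) (x : X) : ℝ :=
  ∑' y : {y : X // T y = x}, Real.exp (g y.1) * w y.1

/-- `h` is a positive fixed point of `L_g : 𝓗 → 𝓗`. -/
def IsPositiveFixedPoint (g h : X → ℝ) : Prop :=
  BoundedLocallyHolder h ∧ (∀ x, 0 < h x) ∧ transfer g h = h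

/-- The normalised operator `M w = h⁻¹ L_g (h w)`. It does not change if `h` is rescaled. -/
def normTransfer (g h : X → ℝ) (w : X → ℝ) (x : X) : ℝ :=
  (h x)⁻¹ * transfer g (fun y => h y * w y) x

/-! ### Bernoulli measures -/

/-- The discrete measurable structure on the alphabet. -/
instance : MeasurableSpace ℕ+ := ⊤

/-- `T_{i_1}⁻¹ ∘ ⋯ ∘ T_{i_n}⁻¹ (0)`, where `T_m⁻¹ x = 1/(m + x)`. -/
def truncation : ℕ → (ℕ → ℕ+) → ℝ
  | 0, _ => 0
  | n + 1, i => 1 / ((i 0 : ℝ) + truncation n (fun k => i (k + 1)))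

/-- The coding map `Π`, sending a digit sequence to the value of its continued fraction. -/
def coding (i : ℕ → ℕ+) : ℝ := limUnder atTop (fun n => truncation n i)

/-- The Bernoulli measure `μ_p = m_p ∘ Π⁻¹`, where `m_p` is the product measure on digit
sequences whose marginals are all equal to the probability vector `p`. -/
def bernoulli (p : PMF ℕ+) : Measure ℝ :=
  (Measure.infinitePi (fun _ : ℕ => p.toMeasure)).map coding

/-- The Hausdorff dimension of a measure, `inf {dim A : μ A = 1}` over Borel sets `A`. -/
def measureDim (μ : Measure ℝ) : ℝ≥0∞ :=
  ⨅ (A : Set ℝ) (_ : MeasurableSet A) (_ : μ A = 1), dimH A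

/-- `ψ = |T'(z₁)|^{-1/4}`, where `z₁ = [0; 1, 1, 1, …]` is the fixed point of `T` with digit `1`. -/
def psi : ℝ := 1 / |deriv gaussFun (coding fun _ => 1)| ^ (1 / 4 : ℝ)

/-- The probability vectors under consideration: positive, decreasing and `O(1/n²)`, with
`dim μ_p > 3/4`, and with either `p₁, p₂ ≥ ε` or `p₁ > ψ`. -/
structure Admissible (ε : ℝ) (p : PMF ℕ+) : Prop where
  pos : ∀ n, 0 < (p n).toReal
  decreasing : ∀ m n : ℕ+, m ≤ n → (p n).toReal ≤ (p m).toReal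
  tail : ∃ K : ℝ, ∀ n : ℕ+, (p n).toReal ≤ K / (n : ℝ) ^ 2
  dim_gt : 3 / 4 < measureDim (bernoulli p)
  large : (ε ≤ (p 1).toReal ∧ ε ≤ (p 2).toReal) ∨ psi < (p 1).toReal

/-- The potential `-b log |T'| + t f_p`, where `f_p` is `log p_n` on `I_n`. -/
def potential (p : PMF ℕ+) (t b : ℝ) (x : X) : ℝ :=
  -b * logDeriv x + t * Real.log (p (digit x)).toReal

/-- `b = β_p(t)`: the solution `b ∈ [0,1]` of `P(-b log |T'| + t f_p) = 0`. -/
def IsBeta (p : PMF ℕ+) (t b : ℝ) : Prop :=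
  b ∈ Set.Icc (0 : ℝ) 1 ∧ HasPressure (potential p t b) 0

end GaussGap

end

noncomputable section

namespace GaussGap

/-! ### Inverse branches of the Gauss map -/

/-! Conjugation by `h` turns the operator into the transfer operator `M` of the normalised potential
`φ = g + log h - log h ∘ T`, which fixes constants. In the coordinate `log (1 + x)` every inverse
branch contracts by `1/2`, whereas `1 / (1 + x)` has Euclidean slope `-1` at `0`. On each branch `t
log p_n` is constant and `b ≤ 1`, so `g` has distortion `2`. The fixed-point equation forces `log h`
to be `4`-Lipschitz (`IsPositiveFixedPoint.log_le`), hence `φ` has distortion `8`, whatever `p` and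
`t` are.

The decay is a cone argument (`LogCone.transfer_sub_const`). `M` improves the log-Lipschitz constant
from `32` to `24`; this gain allows a quarter of the infimum to be subtracted without leaving the
original cone, and by a Harnack inequality the upper bound drops by the factor `1 - 2⁻²⁶`. Hence
`M^n f` is a constant plus an exponentially small cone element, and cone membership converts sup
bounds into Lipschitz bounds.

The limit constant `c` must still be shown to be `∫ f dμ`. Since `μ` is only known to be invariant
and Gibbs, invariance under the dual of `M` is not available at the outset. Instead, decay of
correlations gives `M^n ((S_n (f - c))²) = O(n)`, the Gibbs property transfers this to `∫ (S_n (f -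
c))² dμ = O(n)`, and invariance bounds the same integral below by `n² (∫ (f - c) dμ)²`. -/

theorem X.pos (x : X) : 0 < x.1 :=
  lt_of_le_of_ne x.2.1.1 fun h => x.2.2.ne_zero h.symm

theorem X.lt_one (x : X) : x.1 < 1 :=
  lt_of_le_of_ne x.2.1.2 x.2.2.ne_one

theorem one_le_coe (a : ℕ+) : (1 : ℝ) ≤ (a : ℝ) := by exact_mod_cast (one_le : 1 ≤ a)

/-- The inverse branch `x ↦ 1 / (a + x)` of the Gauss map. -/
def branch (a : ℕ+) (x : X) : X :=
  ⟨1 / ((a : ℝ) + x.1), by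
    have ha := one_le_coe a
    have hx := x.pos
    refine ⟨⟨by positivity, ?_⟩, ?_⟩
    · rw [div_le_one (by linarith)]; linarith
    · rw [one_div]; exact (x.2.2.natCast_add a).inv⟩

theorem one_div_branch (a : ℕ+) (x : X) : 1 / (branch a x).1 = (a : ℝ) + x.1 := by
  simp [branch]

theorem T_branch (a : ℕ+) (x : X) : T (branch a x) = x := by
  apply Subtype.ext
  change Int.fract (1 / (branch a x).1) = x.1
  rw [one_div_branch, Int.fract_natCast_add, Int.fract_eq_self.2 ⟨x.pos.le, x.lt_one⟩]

theorem digit_branch (a : ℕ+) (x : X) : digit (branch a x) = a := by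
  apply PNat.eq
  change ⌊1 / (branch a x).1⌋₊ = a
  rw [one_div_branch, Nat.floor_eq_iff (by have := x.pos; positivity)]
  constructor <;> linarith [x.pos, x.lt_one]

theorem branch_digit_T (x : X) : branch (digit x) (T x) = x := by
  apply Subtype.ext
  have h0 : 0 ≤ 1 / x.1 := by have := x.pos; positivity
  have h : ((digit x : ℕ) : ℝ) + (T x).1 = 1 / x.1 := by
    change ((⌊1 / x.1⌋₊ : ℕ) : ℝ) + Int.fract (1 / x.1) = 1 / x.1
    rw [natCast_floor_eq_intCast_floor h0, Int.floor_add_fract]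
  change 1 / (((digit x : ℕ) : ℝ) + (T x).1) = x.1
  rw [h, one_div_one_div]

/-- The preimages of a point under the Gauss map are its images under the inverse branches. -/
def preimageEquiv (x : X) : ℕ+ ≃ {y : X // T y = x} where
  toFun a := ⟨branch a x, T_branch a x⟩
  invFun y := digit y.1
  left_inv a := digit_branch a x
  right_inv := by
    rintro ⟨y, rfl⟩
    exact Subtype.ext (branch_digit_T y)

theorem transfer_eq_tsum (g w : X → ℝ) (x : X) :
    transfer g w x = ∑' a, Real.exp (g (branch a x)) * w (branch a x) :=
  ((preimageEquiv x).tsum_eq fun y : {y : X // T y = x} => Real.exp (g y.1) * w y.1).symm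

theorem logDeriv_branch (a : ℕ+) (x : X) :
    logDeriv (branch a x) = 2 * Real.log ((a : ℝ) + x.1) := by
  have hx := x.pos
  have hx1 := x.lt_one
  have ha := one_le_coe a
  have hz : (branch a x).1 ≠ 0 := (branch a x).pos.ne'
  -- `gaussFun` is discontinuous, but near a point of the branch the integer part of `1 / w` is
  -- constantly `a`.
  have hloc : gaussFun =ᶠ[𝓝 (branch a x).1] fun w => w⁻¹ - (a : ℝ) := by
    have hc : ContinuousAt (fun w : ℝ => 1 / w) (branch a x).1 :=
      continuousAt_const.div continuousAt_id hz
    have hI : Set.Ioo (a : ℝ) (a + 1) ∈ 𝓝 (1 / (branch a x).1) := by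
      rw [one_div_branch]
      exact Ioo_mem_nhds (by linarith) (by linarith)
    filter_upwards [hc hI] with w hw
    have hfl : ⌊1 / w⌋ = ((a : ℕ) : ℤ) := by
      rw [Int.floor_eq_iff]
      exact ⟨by exact_mod_cast hw.1.le, by exact_mod_cast hw.2⟩
    simp only [gaussFun, Int.fract, hfl]
    simp
  have hd : deriv gaussFun (branch a x).1 = -((branch a x).1 ^ 2)⁻¹ := by
    rw [hloc.deriv_eq, deriv_sub_const, deriv_inv]
  have h1 : ((branch a x).1 ^ 2)⁻¹ = ((a : ℝ) + x.1) ^ 2 := by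
    rw [← one_div_branch a x]; simp
  rw [logDeriv, hd, h1, abs_neg, abs_of_nonneg (by positivity), Real.log_pow]
  norm_num

/-! ### A metric contracted by the inverse branches -/

/-- The distance `|log (1 + x) - log (1 + y)|`. -/
def logDist (x y : X) : ℝ := |Real.log (1 + x.1) - Real.log (1 + y.1)|

theorem logDist_nonneg (x y : X) : 0 ≤ logDist x y := abs_nonneg _

theorem logDist_comm (x y : X) : logDist x y = logDist y x := abs_sub_comm _ _

theorem log_one_add_le {x y : X} (hxy : y.1 ≤ x.1) : Real.log (1 + y.1) ≤ Real.log (1 + x.1) :=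
  Real.log_le_log (by linarith [y.pos]) (by linarith)

theorem logDist_of_le {x y : X} (hxy : y.1 ≤ x.1) :
    logDist x y = Real.log (1 + x.1) - Real.log (1 + y.1) :=
  abs_of_nonneg (sub_nonneg.2 (log_one_add_le hxy))

theorem logDist_le_abs_sub (x y : X) : logDist x y ≤ |x.1 - y.1| := by
  wlog hxy : y.1 ≤ x.1 generalizing x y
  · rw [logDist_comm, abs_sub_comm]
    exact this y x (le_of_not_ge hxy)
  have hx := x.pos
  have hy := y.pos
  rw [logDist_of_le hxy, abs_of_nonneg (sub_nonneg.2 hxy),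
    ← Real.log_div (by positivity) (by positivity)]
  refine (Real.log_le_sub_one_of_pos (by positivity)).trans ?_
  rw [div_sub_one (by positivity), div_le_iff₀ (by positivity)]
  nlinarith

theorem abs_sub_le_logDist (x y : X) : |x.1 - y.1| ≤ 2 * logDist x y := by
  wlog hxy : y.1 ≤ x.1 generalizing x y
  · rw [logDist_comm, abs_sub_comm]
    exact this y x (le_of_not_ge hxy)
  have hx := x.pos
  have hx1 := x.lt_one
  have hy := y.pos
  rw [logDist_of_le hxy, abs_of_nonneg (sub_nonneg.2 hxy),
    ← Real.log_div (by positivity) (by positivity)]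
  have := Real.one_sub_inv_le_log_of_pos (x := (1 + x.1) / (1 + y.1)) (by positivity)
  have h2 : (x.1 - y.1) / 2 ≤ 1 - ((1 + x.1) / (1 + y.1))⁻¹ := by
    rw [inv_div, one_sub_div (by positivity), div_le_div_iff₀ (by norm_num) (by positivity)]
    nlinarith
  linarith

theorem logDist_le_log_two (x y : X) : logDist x y ≤ Real.log 2 := by
  have key : ∀ z : X, 0 ≤ Real.log (1 + z.1) ∧ Real.log (1 + z.1) ≤ Real.log 2 := fun z =>
    ⟨Real.log_nonneg (by linarith [z.pos]),
      Real.log_le_log (by linarith [z.pos]) (by linarith [z.lt_one])⟩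
  rw [logDist, abs_le]
  constructor <;> linarith [(key x).1, (key x).2, (key y).1, (key y).2]

/-- In the coordinate `log (1 + x)` the branch has derivative of modulus `(1 + x) / ((a + x) (a + 1
+ x)) ≤ 1 / (2 + x)`. The proof is the integrated form: the square of the ratio of the images is at
most the ratio of the points. -/
theorem logDist_branch_le (a : ℕ+) (x y : X) :
    logDist (branch a x) (branch a y) ≤ logDist x y / 2 := by
  wlog hxy : y.1 ≤ x.1 generalizing x y
  · rw [logDist_comm, logDist_comm x]
    exact this y x (le_of_not_ge hxy)
  have hx := x.pos
  have hy := y.pos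
  have ha := one_le_coe a
  have hle : (branch a x).1 ≤ (branch a y).1 :=
    one_div_le_one_div_of_le (by positivity) (by linarith)
  rw [logDist_comm, logDist_of_le hle, logDist_of_le hxy,
    ← Real.log_div (by have := (branch a y).pos; positivity)
      (by have := (branch a x).pos; positivity),
    ← Real.log_div (by positivity) (by positivity)]
  set q : ℝ := 1 / (((a : ℝ) + y.1) * (a + 1 + x.1)) with hq
  have hR : (1 + (branch a y).1) / (1 + (branch a x).1) = 1 + q * (x.1 - y.1) := by
    simp only [branch, hq]
    field_simp
    ring
  have hq0 : 0 < q := by positivity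
  have hq1 : q * (1 + y.1) * (2 + x.1) ≤ 1 := by
    rw [hq, one_div_mul_eq_div, div_mul_eq_mul_div, div_le_one (by positivity)]
    apply mul_le_mul <;> linarith
  have hq2 : q ≤ 1 := by nlinarith [mul_pos hq0 hy, mul_pos hq0 hx, mul_pos (mul_pos hq0 hy) hx]
  have hq3 : q * (x.1 - y.1) ≤ x.1 := by nlinarith
  have hsq : (1 + q * (x.1 - y.1)) ^ 2 ≤ (1 + x.1) / (1 + y.1) := by
    rw [le_div_iff₀ (by positivity)]
    have h1 : q * (1 + y.1) * (2 + q * (x.1 - y.1)) ≤ 1 :=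
      le_trans (mul_le_mul_of_nonneg_left (by linarith) (by positivity)) hq1
    nlinarith [mul_le_mul_of_nonneg_left h1 (sub_nonneg.2 hxy)]
  rw [hR]
  have hpos : 0 < 1 + q * (x.1 - y.1) := by nlinarith [mul_nonneg hq0.le (sub_nonneg.2 hxy)]
  have := Real.log_le_log (by positivity) hsq
  rw [Real.log_pow] at this
  push_cast at this
  linarith

theorem abs_log_add_sub_le (a : ℕ+) (x y : X) :
    |Real.log ((a : ℝ) + x.1) - Real.log ((a : ℝ) + y.1)| ≤ logDist x y := by
  wlog hxy : y.1 ≤ x.1 generalizing x y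
  · rw [logDist_comm, abs_sub_comm]
    exact this y x (le_of_not_ge hxy)
  have hx := x.pos
  have hy := y.pos
  have ha := one_le_coe a
  rw [logDist_of_le hxy, abs_of_nonneg
    (sub_nonneg.2 (Real.log_le_log (by positivity) (by linarith))),
    ← Real.log_div (by positivity) (by positivity), ← Real.log_div (by positivity) (by positivity)]
  apply Real.log_le_log (by positivity)
  rw [div_le_div_iff₀ (by positivity) (by positivity)]
  nlinarith

/-- On each branch the potential `φ` is `κ`-Lipschitz for the distance of the base points. -/
def BoundedDistortion (κ : ℝ) (φ : X → ℝ) : Prop :=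
  ∀ a x y, φ (branch a x) ≤ φ (branch a y) + κ * logDist x y

/-- The term `t log p_n` cancels within a branch, leaving `-2 b log (a + x)` with `0 ≤ b ≤ 1`. This
makes the bound uniform in `p` and `t`. -/
theorem boundedDistortion_potential (p : PMF ℕ+) (t b : ℝ) (hb : b ∈ Set.Icc (0 : ℝ) 1) :
    BoundedDistortion 2 (potential p t b) := by
  intro a x y
  have h := abs_le.1 (abs_log_add_sub_le a x y)
  simp only [potential, logDeriv_branch, digit_branch]
  nlinarith [hb.1, hb.2, mul_le_mul_of_nonneg_left h.1 hb.1,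
    mul_le_mul_of_nonneg_right hb.2 (logDist_nonneg x y)]

/-! ### Words -/

/-- The composition `branch (i 0) ∘ ⋯ ∘ branch (i (n - 1))`. -/
def wordBranch : (n : ℕ) → (Fin n → ℕ+) → X → X
  | 0, _, x => x
  | n + 1, i, x => branch (i 0) (wordBranch n (Fin.tail i) x)

theorem iterate_T_wordBranch (n : ℕ) (i : Fin n → ℕ+) (x : X) :
    T^[n] (wordBranch n i x) = x := by
  induction n with
  | zero => rfl
  | succ n ih => rw [wordBranch, Function.iterate_succ_apply, T_branch, ih]

theorem wordBranch_mem_cylinder (n : ℕ) (i : Fin n → ℕ+) (x : X) :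
    wordBranch n i x ∈ cylinder i := by
  induction n with
  | zero => exact fun k => k.elim0
  | succ n ih =>
    intro k
    refine Fin.cases ?_ (fun k => ?_) k
    · exact digit_branch _ _
    · rw [Fin.val_succ, Function.iterate_succ_apply, wordBranch, T_branch]
      exact ih (Fin.tail i) k

theorem T_mem_cylinder_tail {n : ℕ} {i : Fin (n + 1) → ℕ+} {x : X} (hx : x ∈ cylinder i) :
    T x ∈ cylinder (Fin.tail i) := fun k => by
  have := hx k.succ
  rwa [Fin.val_succ, Function.iterate_succ_apply] at this

theorem wordBranch_iterate_T (n : ℕ) (i : Fin n → ℕ+) (x : X) (hx : x ∈ cylinder i) :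
    wordBranch n i (T^[n] x) = x := by
  induction n generalizing x with
  | zero => rfl
  | succ n ih =>
    have h0 : digit x = i 0 := hx 0
    rw [wordBranch, Function.iterate_succ_apply, ih _ _ (T_mem_cylinder_tail hx), ← h0,
      branch_digit_T]

theorem logDist_wordBranch_le (n : ℕ) (i : Fin n → ℕ+) (x y : X) :
    logDist (wordBranch n i x) (wordBranch n i y) ≤ (1 / 2) ^ n * logDist x y := by
  induction n with
  | zero => simp [wordBranch]
  | succ n ih =>
    refine (logDist_branch_le _ _ _).trans ?_
    have := ih (Fin.tail i)
    rw [pow_succ]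
    linarith

theorem logDist_le_of_mem_cylinder {n : ℕ} {i : Fin n → ℕ+} {x y : X} (hx : x ∈ cylinder i)
    (hy : y ∈ cylinder i) : logDist x y ≤ (1 / 2) ^ n := by
  rw [← wordBranch_iterate_T n i x hx, ← wordBranch_iterate_T n i y hy]
  refine (logDist_wordBranch_le n i _ _).trans (mul_le_of_le_one_right (by positivity) ?_)
  exact (logDist_le_log_two _ _).trans (by linarith [Real.log_two_lt_d9])

theorem birkhoff_succ (g : X → ℝ) (n : ℕ) (x : X) :
    birkhoff g (n + 1) x = g x + birkhoff g n (T x) := by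
  simp only [birkhoff, Finset.sum_range_succ', Function.iterate_succ_apply,
    Function.iterate_zero_apply]
  ring

theorem birkhoff_wordBranch_succ (g : X → ℝ) (n : ℕ) (i : Fin (n + 1) → ℕ+) (x : X) :
    birkhoff g (n + 1) (wordBranch (n + 1) i x) =
      g (branch (i 0) (wordBranch n (Fin.tail i) x)) +
        birkhoff g n (wordBranch n (Fin.tail i) x) := by
  rw [birkhoff_succ, wordBranch, T_branch]

/-- The contraction by `1/2` turns the distortions of the single letters into a geometric series;
the factor `1 - (1 / 2) ^ n` in `main` is its partial sum. -/
theorem birkhoff_wordBranch_le {g : X → ℝ} {κ : ℝ} (hκ : 0 ≤ κ)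
    (hg : BoundedDistortion κ g) (n : ℕ) (i : Fin n → ℕ+)
    (x y : X) :
    birkhoff g n (wordBranch n i x) ≤ birkhoff g n (wordBranch n i y) + 2 * κ * logDist x y := by
  have main : birkhoff g n (wordBranch n i x) ≤
      birkhoff g n (wordBranch n i y) + 2 * κ * logDist x y * (1 - (1 / 2) ^ n) := by
    induction n with
    | zero => simp [birkhoff]
    | succ n ih =>
      rw [birkhoff_wordBranch_succ, birkhoff_wordBranch_succ]
      have h1 := hg (i 0) (wordBranch n (Fin.tail i) x) (wordBranch n (Fin.tail i) y)
      have h2 := mul_le_mul_of_nonneg_left (logDist_wordBranch_le n (Fin.tail i) x y) hκ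
      have h3 := ih (Fin.tail i)
      rw [pow_succ]
      linarith
  have h0 : 0 ≤ 2 * κ * logDist x y * (1 / 2) ^ n := by
    have := logDist_nonneg x y
    positivity
  linarith

/-- Iterated summation of a bounded family against nonnegative weights. -/
theorem hasSum_prod_mul {α β : Type*} {W : α → ℝ} {V w : α → β → ℝ} {s : α → ℝ}
    {B S : ℝ} (hW0 : ∀ i, 0 ≤ W i) (hV0 : ∀ i a, 0 ≤ V i a) (hW : Summable W)
    (hV : ∀ i, HasSum (V i) 1) (hw : ∀ i a, |w i a| ≤ B)
    (hs : ∀ i, HasSum (fun a => V i a * w i a) (s i)) (hS : HasSum (fun i => W i * s i) S) :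
    HasSum (fun q : α × β => W q.1 * V q.1 q.2 * w q.1 q.2) S := by
  have hG0 : ∀ q : α × β, 0 ≤ W q.1 * V q.1 q.2 := fun q => mul_nonneg (hW0 _) (hV0 _ _)
  have hGs : Summable fun q : α × β => W q.1 * V q.1 q.2 := by
    rw [summable_prod_of_nonneg hG0]
    refine ⟨fun i => ((hV i).mul_left (W i)).summable, ?_⟩
    refine (summable_congr fun i => ?_).2 hW
    exact ((hV i).mul_left (W i)).tsum_eq.trans (mul_one _)
  have hF : Summable fun q : α × β => W q.1 * V q.1 q.2 * w q.1 q.2 := by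
    refine Summable.of_norm_bounded (hGs.mul_right B) fun q => ?_
    rw [Real.norm_eq_abs, abs_mul, abs_of_nonneg (hG0 q)]
    exact mul_le_mul_of_nonneg_left (hw _ _) (hG0 q)
  have hfib := hF.hasSum.prod_fiberwise (g := fun i => W i * s i) fun i => by
    simpa only [mul_assoc] using (hs i).mul_left (W i)
  rw [← hfib.unique hS]
  exact hF.hasSum

/-! ### Normalised transfer operators -/

/-- The potential `φ` is normalised: its transfer operator fixes the constant `1`. -/
def Normalized (φ : X → ℝ) : Prop :=
  ∀ x, HasSum (fun a => Real.exp (φ (branch a x))) 1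

namespace Normalized

variable {φ : X → ℝ}

theorem hasSum_transfer (hφ : Normalized φ) {w : X → ℝ} {B : ℝ} (hw : ∀ x, |w x| ≤ B) (x : X) :
    HasSum (fun a => Real.exp (φ (branch a x)) * w (branch a x)) (transfer φ w x) := by
  rw [transfer_eq_tsum]
  refine (Summable.of_norm_bounded ((hφ x).summable.mul_right B) fun a => ?_).hasSum
  rw [Real.norm_eq_abs, abs_mul, abs_of_pos (Real.exp_pos _)]
  exact mul_le_mul_of_nonneg_left (hw _) (Real.exp_pos _).le

theorem transfer_const (hφ : Normalized φ) (c : ℝ) (x : X) : transfer φ (fun _ => c) x = c := by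
  have := (hφ.hasSum_transfer (w := fun _ => c) (fun _ => le_rfl) x).unique ((hφ x).mul_right c)
  rwa [one_mul] at this

theorem transfer_mono (hφ : Normalized φ) {w w' : X → ℝ} {B B' : ℝ} (hw : ∀ x, |w x| ≤ B)
    (hw' : ∀ x, |w' x| ≤ B') (h : ∀ x, w x ≤ w' x) (x : X) : transfer φ w x ≤ transfer φ w' x :=
  hasSum_le (fun _ => mul_le_mul_of_nonneg_left (h _) (Real.exp_pos _).le)
    (hφ.hasSum_transfer hw x) (hφ.hasSum_transfer hw' x)

theorem transfer_le (hφ : Normalized φ) {w : X → ℝ} {B s : ℝ} (hw : ∀ x, |w x| ≤ B)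
    (h : ∀ x, w x ≤ s) (x : X) : transfer φ w x ≤ s :=
  (hφ.transfer_mono hw (fun _ => le_rfl) h x).trans_eq (hφ.transfer_const s x)

theorem le_transfer (hφ : Normalized φ) {w : X → ℝ} {B s : ℝ} (hw : ∀ x, |w x| ≤ B)
    (h : ∀ x, s ≤ w x) (x : X) : s ≤ transfer φ w x :=
  (hφ.transfer_const s x).symm.trans_le (hφ.transfer_mono (fun _ => le_rfl) hw h x)

theorem abs_transfer_le (hφ : Normalized φ) {w : X → ℝ} {B : ℝ} (hw : ∀ x, |w x| ≤ B) (x : X) :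
    |transfer φ w x| ≤ B :=
  abs_le.2 ⟨hφ.le_transfer hw (fun x => (abs_le.1 (hw x)).1) x,
    hφ.transfer_le hw (fun x => (abs_le.1 (hw x)).2) x⟩

theorem transfer_add (hφ : Normalized φ) {w w' : X → ℝ} {B B' : ℝ} (hw : ∀ x, |w x| ≤ B)
    (hw' : ∀ x, |w' x| ≤ B') :
    transfer φ (fun x => w x + w' x) = fun x => transfer φ w x + transfer φ w' x := by
  funext x
  rw [transfer_eq_tsum]
  simp only [mul_add]
  exact ((hφ.hasSum_transfer hw x).add (hφ.hasSum_transfer hw' x)).tsum_eq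

theorem transfer_add_const (hφ : Normalized φ) {w : X → ℝ} {B : ℝ} (hw : ∀ x, |w x| ≤ B)
    (c : ℝ) : transfer φ (fun x => w x + c) = fun x => transfer φ w x + c := by
  rw [hφ.transfer_add hw (fun _ => le_rfl)]
  simp only [hφ.transfer_const]

end Normalized

theorem transfer_const_mul (φ : X → ℝ) (c : ℝ) (w : X → ℝ) :
    transfer φ (fun x => c * w x) = fun x => c * transfer φ w x := by
  funext x
  simp only [transfer_eq_tsum, ← tsum_mul_left]
  exact tsum_congr fun a => by ring

/-- A function of `T y` is constant over the preimages of a point. This identity replaces the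
duality with an invariant measure in the correlation estimates. -/
theorem transfer_comp_T_mul (φ u v : X → ℝ) :
    transfer φ (fun x => v (T x) * u x) = fun x => v x * transfer φ u x := by
  funext x
  simp only [transfer_eq_tsum, ← tsum_mul_left, T_branch]
  exact tsum_congr fun a => by ring

namespace Normalized

variable {φ : X → ℝ}

theorem abs_iterate_le (hφ : Normalized φ) {w : X → ℝ} {B : ℝ} (hw : ∀ x, |w x| ≤ B) (n : ℕ)
    (x : X) : |(transfer φ)^[n] w x| ≤ B := by
  induction n generalizing w with
  | zero => exact hw x
  | succ n ih => exact ih (hφ.abs_transfer_le hw)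

theorem iterate_add (hφ : Normalized φ) {w w' : X → ℝ} {B B' : ℝ} (hw : ∀ x, |w x| ≤ B)
    (hw' : ∀ x, |w' x| ≤ B') (n : ℕ) :
    (transfer φ)^[n] (fun x => w x + w' x) =
      fun x => (transfer φ)^[n] w x + (transfer φ)^[n] w' x := by
  induction n generalizing w w' with
  | zero => rfl
  | succ n ih =>
    simp only [Function.iterate_succ_apply]
    rw [hφ.transfer_add hw hw', ih (hφ.abs_transfer_le hw) (hφ.abs_transfer_le hw')]

theorem iterate_const (hφ : Normalized φ) (c : ℝ) (n : ℕ) :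
    (transfer φ)^[n] (fun _ => c) = fun _ => c := by
  induction n with
  | zero => rfl
  | succ n ih =>
    rw [Function.iterate_succ_apply, show transfer φ (fun _ => c) = fun _ => c from
      funext (hφ.transfer_const c), ih]

theorem iterate_mono (hφ : Normalized φ) {w w' : X → ℝ} {B B' : ℝ} (hw : ∀ x, |w x| ≤ B)
    (hw' : ∀ x, |w' x| ≤ B') (h : ∀ x, w x ≤ w' x) (n : ℕ) (x : X) :
    (transfer φ)^[n] w x ≤ (transfer φ)^[n] w' x := by
  induction n generalizing w w' with
  | zero => exact h x
  | succ n ih =>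
    exact ih (hφ.abs_transfer_le hw) (hφ.abs_transfer_le hw') (hφ.transfer_mono hw hw' h)

theorem iterate_const_mul (c : ℝ) (w : X → ℝ) (n : ℕ) :
    (transfer φ)^[n] (fun x => c * w x) = fun x => c * (transfer φ)^[n] w x := by
  induction n generalizing w with
  | zero => rfl
  | succ n ih => rw [Function.iterate_succ_apply, transfer_const_mul, ih]; rfl

/-- The iterates of the transfer operator as sums over words. -/
theorem hasSum_iterate (hφ : Normalized φ) {w : X → ℝ} {B : ℝ} (hw : ∀ x, |w x| ≤ B) (n : ℕ)
    (x : X) :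
    HasSum (fun i : Fin n → ℕ+ =>
      Real.exp (birkhoff φ n (wordBranch n i x)) * w (wordBranch n i x))
      ((transfer φ)^[n] w x) := by
  induction n generalizing w B with
  | zero =>
    simp [birkhoff, wordBranch]
  | succ n ih =>
    have hF' := hasSum_prod_mul (fun i => (Real.exp_pos (birkhoff φ n (wordBranch n i x))).le)
      (fun i a => (Real.exp_pos (φ (branch a (wordBranch n i x)))).le)
      (by simpa only [mul_one] using (ih (w := fun _ => 1) (B := 1) (by simp)).summable)
      (fun i => hφ (wordBranch n i x)) (fun i a => hw (branch a (wordBranch n i x)))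
      (fun i => hφ.hasSum_transfer hw (wordBranch n i x)) (ih (hφ.abs_transfer_le hw))
    rw [Function.iterate_succ_apply,
      -- Expanding `M^n (M w)` puts the new letter outermost, so it is prepended to the word.
      ← ((Equiv.prodComm _ _).trans (Fin.consEquiv fun _ => ℕ+)).hasSum_iff]
    convert hF' using 1
    funext q
    have h0 : (((Equiv.prodComm _ _).trans (Fin.consEquiv fun _ => ℕ+)) q : Fin (n + 1) → ℕ+)
        = Fin.cons q.2 q.1 := rfl
    rw [Function.comp_apply, h0, birkhoff_wordBranch_succ, wordBranch, Fin.cons_zero,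
      Fin.tail_cons, Real.exp_add, mul_comm (Real.exp (φ _))]

end Normalized

/-! ### Contraction on a cone -/

instance : Nonempty X :=
  ⟨⟨√2 - 1, ⟨by linarith [Real.one_lt_sqrt_two], by linarith [Real.sqrt_two_lt_three_halves]⟩,
    by simpa using irrational_sqrt_two.sub_natCast 1⟩⟩

/-- The cone of nonnegative functions whose logarithm is `κ`-Lipschitz for `logDist`. -/
def LogCone (κ : ℝ) (u : X → ℝ) : Prop :=
  (∀ x, 0 ≤ u x) ∧ ∀ x y, u x ≤ Real.exp (κ * logDist x y) * u y

theorem exp_mul_logDist_le (k : ℕ) (x y : X) : Real.exp (k * logDist x y) ≤ 2 ^ k := by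
  rw [Real.exp_nat_mul]
  refine pow_le_pow_left₀ (Real.exp_pos _).le ?_ k
  rw [← Real.le_log_iff_exp_le (by norm_num)]
  exact logDist_le_log_two x y

/-- From `e^z - 1 ≤ z e^z` with `z = 32 * logDist x y`: the factor `e^z` is at most `2 ^ 32`, and
`32 * 2 ^ 32 = 2 ^ 37`. -/
theorem LogCone.sub_le {u : X → ℝ} {s : ℝ} (hu : LogCone 32 u) (hs : ∀ x, u x ≤ s) (x y : X) :
    u x - u y ≤ 2 ^ 37 * s * logDist x y := by
  have hd := logDist_nonneg x y
  have h1 : Real.exp (32 * logDist x y) - 1 ≤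
      32 * logDist x y * Real.exp (32 * logDist x y) := by
    have h := Real.add_one_le_exp (-(32 * logDist x y))
    have h2 := mul_le_mul_of_nonneg_right h (Real.exp_pos (32 * logDist x y)).le
    rw [← Real.exp_add, neg_add_cancel, Real.exp_zero] at h2
    linarith
  have h2 : Real.exp (32 * logDist x y) ≤ 2 ^ 32 := by exact_mod_cast exp_mul_logDist_le 32 x y
  calc u x - u y ≤ (Real.exp (32 * logDist x y) - 1) * u y := by linarith [hu.2 x y]
    _ ≤ (32 * logDist x y * 2 ^ 32) * s := by
      refine mul_le_mul (h1.trans ?_) (hs y) (hu.1 y) (by positivity)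
      exact mul_le_mul_of_nonneg_left h2 (by positivity)
    _ = _ := by ring

/-- The branches halve `32` to `16`, and the distortion of `φ` adds `8`. -/
theorem LogCone.transfer {φ : X → ℝ} (hφ : Normalized φ) (hd : BoundedDistortion 8 φ) {u : X → ℝ}
    {s : ℝ} (hu : LogCone 32 u) (hs : ∀ x, u x ≤ s) : LogCone 24 (transfer φ u) := by
  have hb : ∀ x, |u x| ≤ s := fun x => by rw [abs_of_nonneg (hu.1 x)]; exact hs x
  refine ⟨fun x => hφ.le_transfer hb hu.1 x, fun x y => ?_⟩
  refine hasSum_le (fun a => ?_) (hφ.hasSum_transfer hb x) ((hφ.hasSum_transfer hb y).mul_left _)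
  have h1 : Real.exp (φ (branch a x)) ≤
      Real.exp (8 * logDist x y) * Real.exp (φ (branch a y)) := by
    rw [← Real.exp_add]
    exact Real.exp_le_exp.2 (by linarith [hd a x y])
  have h2 : u (branch a x) ≤ Real.exp (16 * logDist x y) * u (branch a y) := by
    refine (hu.2 _ (branch a y)).trans (mul_le_mul_of_nonneg_right ?_ (hu.1 _))
    exact Real.exp_le_exp.2 (by linarith [logDist_branch_le a x y])
  calc _ ≤ (Real.exp (8 * logDist x y) * Real.exp (φ (branch a y))) *
        (Real.exp (16 * logDist x y) * u (branch a y)) :=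
        mul_le_mul h1 h2 (hu.1 _) (by positivity)
    _ = Real.exp (8 * logDist x y + 16 * logDist x y) *
        (Real.exp (φ (branch a y)) * u (branch a y)) := by rw [Real.exp_add]; ring
    _ = _ := by ring_nf

/-- Subtracting a fixed proportion of the infimum keeps a function inside a larger cone. -/
theorem LogCone.sub_const {v : X → ℝ} (hv : LogCone 24 v) {ι : ℝ} (hι : 0 ≤ ι)
    (hle : ∀ x, ι ≤ v x) : LogCone 32 fun x => v x - ι / 4 := by
  refine ⟨fun x => by linarith [hle x], fun x y => ?_⟩
  have hd := logDist_nonneg x y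
  set E := Real.exp (8 * logDist x y) with hE
  have hE1 : 1 ≤ E := Real.one_le_exp (by positivity)
  have h24 : Real.exp (24 * logDist x y) = E ^ 3 := by rw [hE, ← Real.exp_nat_mul]; ring_nf
  have h32 : Real.exp (32 * logDist x y) = E ^ 4 := by rw [hE, ← Real.exp_nat_mul]; ring_nf
  have hxy := hv.2 x y
  rw [h24] at hxy
  simp only [h32]
  -- The proportion `1/4` enters here: since `v y ≥ ι`, the cone condition reduces to this
  -- inequality, whose defect has the double root `E = 1`.
  have h3 : E ^ 4 - 1 ≤ 4 * (E ^ 4 - E ^ 3) := by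
    have hf : 4 * (E ^ 4 - E ^ 3) - (E ^ 4 - 1) =
        (E - 1) * ((E - 1) * (3 * E ^ 2 + 2 * E + 1)) := by ring
    have h0 : 0 ≤ E - 1 := by linarith
    have : 0 ≤ (E - 1) * ((E - 1) * (3 * E ^ 2 + 2 * E + 1)) := by positivity
    linarith
  have h4 : 0 ≤ E ^ 4 - E ^ 3 := by
    have : 1 ≤ E ^ 4 := one_le_pow₀ hE1
    linarith
  have h5 := mul_le_mul_of_nonneg_right (hle y) h4
  have h6 := mul_le_mul_of_nonneg_left h3 hι
  nlinarith

/-- One step of the contraction. Diameter at most `log 2` gives the Harnack inequality `sup v ≤ 2 ^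
24 * inf v`, so subtracting `inf v / 4` removes at least `v x / 2 ^ 26` at every point. -/
theorem LogCone.transfer_sub_const {φ : X → ℝ} (hφ : Normalized φ) (hd : BoundedDistortion 8 φ)
    {u : X → ℝ} {s : ℝ} (hu : LogCone 32 u) (hs : ∀ x, u x ≤ s) :
    ∃ c, LogCone 32 (fun x => GaussGap.transfer φ u x - c) ∧
      ∀ x, GaussGap.transfer φ u x - c ≤ (1 - 1 / 2 ^ 26) * s := by
  have hb : ∀ x, |u x| ≤ s := fun x => by rw [abs_of_nonneg (hu.1 x)]; exact hs x
  have hv := hu.transfer hφ hd hs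
  set v := GaussGap.transfer φ u with hvdef
  have hbdd : BddBelow (Set.range v) := ⟨0, by rintro _ ⟨x, rfl⟩; exact hv.1 x⟩
  have hle : ∀ x, (⨅ z, v z) ≤ v x := fun x => ciInf_le hbdd x
  have h0 : 0 ≤ ⨅ z, v z := le_ciInf hv.1
  refine ⟨(⨅ z, v z) / 4, hv.sub_const h0 hle, fun x => ?_⟩
  have h1 : v x / 2 ^ 24 ≤ ⨅ z, v z := le_ciInf fun z => by
    rw [div_le_iff₀ (by positivity), mul_comm]
    refine (hv.2 x z).trans (mul_le_mul_of_nonneg_right ?_ (hv.1 z))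
    exact_mod_cast exp_mul_logDist_le 24 x z
  have h2 : v x ≤ s := hφ.transfer_le hb hs x
  norm_num at h1 ⊢
  linarith

theorem iterate_eq_cone_add_const {φ : X → ℝ} (hφ : Normalized φ) (hd : BoundedDistortion 8 φ)
    {f : X → ℝ} {s : ℝ} (hf : LogCone 32 f) (hs : ∀ x, f x ≤ s) (n : ℕ) :
    ∃ c u, LogCone 32 u ∧ (∀ x, u x ≤ (1 - 1 / 2 ^ 26) ^ n * s) ∧
      (transfer φ)^[n] f = fun x => u x + c := by
  induction n with
  | zero => exact ⟨0, f, hf, by simpa using hs, by simp⟩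
  | succ n ih =>
    obtain ⟨c, u, hu, hus, hfu⟩ := ih
    obtain ⟨c', hc', hs'⟩ := hu.transfer_sub_const hφ hd hus
    refine ⟨c' + c, _, hc', fun x => (hs' x).trans_eq (by ring), ?_⟩
    rw [Function.iterate_succ_apply', hfu, hφ.transfer_add_const (B := (1 - 1 / 2 ^ 26) ^ n * s)
      fun x => by rw [abs_of_nonneg (hu.1 x)]; exact hus x]
    funext x
    ring

/-- The iterates of a Lipschitz function become constant exponentially fast, in the Lipschitz
norm. -/
theorem iterate_sub_le {φ : X → ℝ} (hφ : Normalized φ) (hd : BoundedDistortion 8 φ)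
    {f : X → ℝ} {A B : ℝ} (hB : ∀ x, |f x| ≤ B) (hA : ∀ x y, |f x - f y| ≤ A * |x.1 - y.1|)
    (hA0 : 0 ≤ A) (n : ℕ) :
    (∃ c, ∀ x, c ≤ (transfer φ)^[n] f x ∧
      (transfer φ)^[n] f x ≤ c + (1 - 1 / 2 ^ 26) ^ n * (2 * (A + B))) ∧
    ∀ x y, (transfer φ)^[n] f x - (transfer φ)^[n] f y ≤
      2 ^ 38 * (1 - 1 / 2 ^ 26) ^ n * (A + B) * |x.1 - y.1| := by
  have hB0 : 0 ≤ B := (abs_nonneg _).trans (hB (Classical.arbitrary X))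
  -- Adding `B` gives positivity. The extra `A / 16` absorbs the variation of `f`, which is `2 *
  -- A`-Lipschitz for `logDist`: `2 * A = 32 * (A / 16)`.
  have hcone : LogCone 32 fun x => f x + (B + A / 16) := by
    refine ⟨fun x => by linarith [(abs_le.1 (hB x)).1], fun x y => ?_⟩
    have hd0 := logDist_nonneg x y
    have h1 := (le_abs_self _).trans (hA x y)
    have h2 := mul_le_mul_of_nonneg_left (abs_sub_le_logDist x y) hA0
    have h3 := Real.add_one_le_exp (32 * logDist x y)
    have h4 := (abs_le.1 (hB y)).1
    have h5 : (32 * logDist x y) * (A / 16) ≤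
        (Real.exp (32 * logDist x y) - 1) * (f y + (B + A / 16)) :=
      mul_le_mul (by linarith) (by linarith) (by positivity) (by linarith)
    linarith
  have hs : ∀ x, f x + (B + A / 16) ≤ 2 * (A + B) := fun x => by
    linarith [(abs_le.1 (hB x)).2]
  obtain ⟨c, u, hu, hus, hfu⟩ := iterate_eq_cone_add_const hφ hd hcone hs n
  rw [hφ.iterate_add hB fun _ => le_rfl, hφ.iterate_const] at hfu
  have hx : ∀ x, (transfer φ)^[n] f x = u x + (c - (B + A / 16)) := fun x => by
    linarith [congrFun hfu x]
  refine ⟨⟨c - (B + A / 16), fun x => ?_⟩, fun x y => ?_⟩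
  · rw [hx]
    constructor <;> linarith [hu.1 x, hus x]
  · rw [hx, hx]
    have hρ : (0 : ℝ) ≤ (1 - 1 / 2 ^ 26) ^ n := pow_nonneg (by norm_num) n
    have h1 := hu.sub_le hus x y
    have h2 := mul_le_mul_of_nonneg_left (logDist_le_abs_sub x y)
      (show 0 ≤ 2 ^ 37 * ((1 - 1 / 2 ^ 26) ^ n * (2 * (A + B))) by positivity)
    linarith

/-- The iterates of a Lipschitz function converge to a constant. -/
theorem exists_limit_iterate {φ : X → ℝ} (hφ : Normalized φ) (hd : BoundedDistortion 8 φ)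
    {f : X → ℝ} {A B : ℝ} (hB : ∀ x, |f x| ≤ B) (hA : ∀ x y, |f x - f y| ≤ A * |x.1 - y.1|)
    (hA0 : 0 ≤ A) :
    ∃ c, ∀ n x, |(transfer φ)^[n] f x - c| ≤ (1 - 1 / 2 ^ 26) ^ n * (2 * (A + B)) := by
  have hosc : ∀ n, ∃ c, ∀ x, c ≤ (transfer φ)^[n] f x ∧
      (transfer φ)^[n] f x ≤ c + (1 - 1 / 2 ^ 26) ^ n * (2 * (A + B)) := fun n =>
    (iterate_sub_le hφ hd hB hA hA0 n).1
  choose c hc using hosc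
  set x₀ := Classical.arbitrary X
  -- `M` is monotone and fixes constants, so the interval containing the values of the `n`-th
  -- iterate contains those of all later ones.
  have hnm : ∀ n m, n ≤ m → ∀ x, c n ≤ (transfer φ)^[m] f x ∧
      (transfer φ)^[m] f x ≤ c n + (1 - 1 / 2 ^ 26) ^ n * (2 * (A + B)) := by
    intro n m hm x
    obtain ⟨k, rfl⟩ := Nat.exists_eq_add_of_le' hm
    rw [Function.iterate_add_apply]
    have hb := hφ.abs_iterate_le hB n
    have h1 := hφ.iterate_mono (fun _ => le_rfl) hb (fun x => (hc n x).1) k x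
    have h2 := hφ.iterate_mono hb (fun _ => le_rfl) (fun x => (hc n x).2) k x
    rw [hφ.iterate_const] at h1 h2
    exact ⟨h1, h2⟩
  have hlim : Tendsto (fun n => (1 - 1 / 2 ^ 26 : ℝ) ^ n * (2 * (A + B))) atTop (𝓝 0) := by
    rw [← zero_mul (2 * (A + B))]
    exact (tendsto_pow_atTop_nhds_zero_of_lt_one (by norm_num) (by norm_num)).mul_const _
  have hcau : CauchySeq fun n => (transfer φ)^[n] f x₀ := by
    refine cauchySeq_of_le_tendsto_0' _ (fun n m hm => ?_) hlim
    rw [Real.dist_eq, abs_le]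
    constructor <;> linarith [(hnm n n le_rfl x₀).1, (hnm n n le_rfl x₀).2, (hnm n m hm x₀).1,
      (hnm n m hm x₀).2]
  obtain ⟨l, hl⟩ := cauchySeq_tendsto_of_complete hcau
  refine ⟨l, fun n x => ?_⟩
  have h1 : c n ≤ l := ge_of_tendsto hl (eventually_atTop.2 ⟨n, fun m hm => (hnm n m hm x₀).1⟩)
  have h2 : l ≤ c n + (1 - 1 / 2 ^ 26) ^ n * (2 * (A + B)) :=
    le_of_tendsto hl (eventually_atTop.2 ⟨n, fun m hm => (hnm n m hm x₀).2⟩)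
  rw [abs_le]
  constructor <;> linarith [(hc n x).1, (hc n x).2]

/-! ### Birkhoff sums are small in mean square -/

theorem abs_birkhoff_le {f : X → ℝ} {B : ℝ} (hf : ∀ x, |f x| ≤ B) (n : ℕ) (x : X) :
    |birkhoff f n x| ≤ n * B := by
  refine (Finset.abs_sum_le_sum_abs _ _).trans ?_
  simpa using Finset.sum_le_sum fun k (_ : k ∈ Finset.range n) => hf (T^[k] x)

theorem abs_mul_le_mul {a b A B : ℝ} (ha : |a| ≤ A) (hb : |b| ≤ B) : |a * b| ≤ A * B := by
  rw [abs_mul]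
  exact mul_le_mul ha hb (abs_nonneg _) ((abs_nonneg _).trans ha)

namespace Normalized

variable {φ : X → ℝ}

theorem iterate_birkhoff_mul_succ (hφ : Normalized φ) {f u : X → ℝ} {B C : ℝ}
    (hf : ∀ x, |f x| ≤ B) (hu : ∀ x, |u x| ≤ C) (n : ℕ) (x : X) :
    (transfer φ)^[n + 1] (fun x => birkhoff f (n + 1) x * u x) x =
      (transfer φ)^[n + 1] (fun x => f x * u x) x +
        (transfer φ)^[n] (fun x => birkhoff f n x * transfer φ u x) x := by
  have h1 : (fun x => birkhoff f (n + 1) x * u x) =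
      fun x => f x * u x + birkhoff f n (T x) * u x := by
    funext x
    rw [birkhoff_succ, add_mul]
  have hfu : ∀ x, |f x * u x| ≤ B * C := fun x => abs_mul_le_mul (hf x) (hu x)
  rw [Function.iterate_succ_apply, Function.iterate_succ_apply, h1,
    hφ.transfer_add hfu fun x => abs_mul_le_mul (abs_birkhoff_le hf n (T x)) (hu x),
    transfer_comp_T_mul, hφ.iterate_add (hφ.abs_transfer_le hfu)
      fun x => abs_mul_le_mul (abs_birkhoff_le hf n x) (hφ.abs_transfer_le hu x)]

/-- Each step of the recursion splits off a term of size at most `B * C` and replaces `u` by `M u`,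
hence `C` by `ρ * C`; the geometric series makes the bound independent of `n`. -/
theorem abs_iterate_birkhoff_mul_le (hφ : Normalized φ) {f u : X → ℝ} {B C ρ : ℝ}
    (hf : ∀ x, |f x| ≤ B) (hρ1 : ρ < 1)
    (hu : ∀ n x, |(transfer φ)^[n] u x| ≤ ρ ^ n * C) (n : ℕ) (x : X) :
    |(transfer φ)^[n] (fun x => birkhoff f n x * u x) x| ≤ B * (C / (1 - ρ)) := by
  have hB : 0 ≤ B := (abs_nonneg _).trans (hf x)
  have h1ρ : 0 < 1 - ρ := sub_pos.2 hρ1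
  induction n generalizing u C with
  | zero =>
    have hC : 0 ≤ C := by simpa using (abs_nonneg _).trans (hu 0 x)
    simp only [birkhoff, Finset.range_zero, Finset.sum_empty, zero_mul,
      Function.iterate_zero_apply, abs_zero]
    positivity
  | succ n ih =>
    have hu0 : ∀ x, |u x| ≤ C := fun x => by simpa using hu 0 x
    rw [hφ.iterate_birkhoff_mul_succ hf hu0]
    have h1 := hφ.abs_iterate_le (fun x => abs_mul_le_mul (hf x) (hu0 x)) (n + 1) x
    have h2 := ih (u := transfer φ u) (C := ρ * C) fun n x => by
      rw [← Function.iterate_succ_apply]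
      exact (hu (n + 1) x).trans_eq (by ring)
    refine (abs_add_le _ _).trans ((add_le_add h1 h2).trans_eq ?_)
    field_simp
    ring

/-- Linear growth of the variance. With `S_{n+1} f = f + S_n f ∘ T`, the increment consists of the
diagonal term `f²` and twice the correlation of `S_n f` with `M f`, both bounded independently of
`n`. -/
theorem iterate_birkhoff_sq_le (hφ : Normalized φ) {f : X → ℝ} {B C ρ : ℝ}
    (hf : ∀ x, |f x| ≤ B) (hρ0 : 0 ≤ ρ) (hρ1 : ρ < 1)
    (hC : ∀ n x, |(transfer φ)^[n] f x| ≤ ρ ^ n * C) (n : ℕ) (x : X) :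
    (transfer φ)^[n] (fun x => birkhoff f n x ^ 2) x ≤ n * (B ^ 2 + 2 * (B * (C / (1 - ρ)))) := by
  induction n with
  | zero => simp [birkhoff]
  | succ n ih =>
    have hS := abs_birkhoff_le hf n
    have hMf := hφ.abs_transfer_le hf
    have hC0 : 0 ≤ C := by simpa using (abs_nonneg _).trans (hC 0 x)
    have hb1 : ∀ x, |2 * f x + birkhoff f n (T x)| ≤ 2 * B + n * B := fun x =>
      (abs_add_le _ _).trans (add_le_add
        (by rw [abs_mul, abs_two]; linarith [hf x]) (hS (T x)))
    have hff : ∀ x, |f x * f x| ≤ B * B := fun x => abs_mul_le_mul (hf x) (hf x)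
    have hexp : (fun x => birkhoff f (n + 1) x ^ 2) =
        fun x => f x * f x + birkhoff f n (T x) * (2 * f x + birkhoff f n (T x)) := by
      funext x
      rw [birkhoff_succ]
      ring
    have hin : transfer φ (fun x => 2 * f x + birkhoff f n (T x)) =
        fun x => 2 * transfer φ f x + birkhoff f n x := by
      have h1 := transfer_comp_T_mul φ (fun _ => 1) (birkhoff f n)
      simp only [mul_one, hφ.transfer_const] at h1
      rw [hφ.transfer_add (B := 2 * B) (fun x => by rw [abs_mul, abs_two]; linarith [hf x])
        (fun x => hS (T x)), h1, transfer_const_mul]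
    have hprod : (fun x => birkhoff f n x * (2 * transfer φ f x + birkhoff f n x)) =
        fun x => 2 * (birkhoff f n x * transfer φ f x) + birkhoff f n x ^ 2 := by
      funext x
      ring
    have hbS : ∀ x, |birkhoff f n x * transfer φ f x| ≤ n * B * B := fun x =>
      abs_mul_le_mul (hS x) (hMf x)
    have hb2 : ∀ x, |2 * (birkhoff f n x * transfer φ f x)| ≤ 2 * (n * B * B) := fun x => by
      rw [abs_mul, abs_two]
      linarith [hbS x]
    have hsq : ∀ x, |birkhoff f n x ^ 2| ≤ n * B * (n * B) := fun x => by
      rw [sq]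
      exact abs_mul_le_mul (hS x) (hS x)
    rw [Function.iterate_succ_apply, hexp,
      hφ.transfer_add hff (fun x => abs_mul_le_mul (hS (T x)) (hb1 x)), transfer_comp_T_mul, hin,
      hprod, hφ.iterate_add (hφ.abs_transfer_le hff) (B' := 2 * (n * B * B) + n * B * (n * B))
        (fun x => (abs_add_le _ _).trans (add_le_add (hb2 x) (hsq x))),
      hφ.iterate_add hb2 hsq, iterate_const_mul]
    have h1 := (abs_le.1 (hφ.abs_iterate_le (hφ.abs_transfer_le hff) n x)).2
    have h2 := (abs_le.1 (hφ.abs_iterate_birkhoff_mul_le hf hρ1 (u := transfer φ f) (C := C)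
      (fun k y => by
        rw [← Function.iterate_succ_apply]
        refine (hC (k + 1) y).trans (mul_le_mul_of_nonneg_right ?_ hC0)
        exact pow_le_pow_of_le_one hρ0 hρ1.le k.le_succ) n x)).2
    push_cast
    linarith

end Normalized

theorem abs_birkhoff_sub_le {f : X → ℝ} {A : ℝ} (hA0 : 0 ≤ A)
    (hA : ∀ x y, |f x - f y| ≤ A * |x.1 - y.1|) (n : ℕ) (i : Fin n → ℕ+) {x y : X}
    (hx : x ∈ cylinder i) (hy : y ∈ cylinder i) :
    |birkhoff f n x - birkhoff f n y| ≤ 2 * A := by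
  have main : |birkhoff f n x - birkhoff f n y| ≤ 2 * A * (1 - (1 / 2) ^ n) := by
    induction n generalizing x y with
    | zero => simp [birkhoff]
    | succ n ih =>
      have h1 := ih _ (T_mem_cylinder_tail hx) (T_mem_cylinder_tail hy)
      have h2 := (hA x y).trans (mul_le_mul_of_nonneg_left ((abs_sub_le_logDist x y).trans
        (mul_le_mul_of_nonneg_left (logDist_le_of_mem_cylinder hx hy) zero_le_two)) hA0)
      rw [birkhoff_succ, birkhoff_succ, add_sub_add_comm]
      refine (abs_add_le _ _).trans ((add_le_add h2 h1).trans_eq ?_)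
      ring
  have : 0 ≤ 2 * A * (1 / 2) ^ n := by positivity
  linarith

/-! ### Integration over cylinders -/

theorem measurable_digit : Measurable digit := by
  refine measurable_to_countable' fun a => ?_
  have h : digit ⁻¹' {a} = {x : X | ⌊1 / x.1⌋₊ = (a : ℕ)} := by
    ext x
    exact ⟨fun h => congrArg PNat.val h, fun h => PNat.eq h⟩
  rw [h]
  exact (Nat.measurable_floor.comp (measurable_const.div measurable_subtype_coe))
    (measurableSet_singleton (a : ℕ))

theorem measurableSet_cylinder (hT : Measurable T) {n : ℕ} (i : Fin n → ℕ+) :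
    MeasurableSet (cylinder i) := by
  have h : cylinder i = ⋂ k : Fin n, (fun x => digit (T^[k] x)) ⁻¹' {i k} := by
    ext x
    simp [cylinder]
  rw [h]
  exact MeasurableSet.iInter fun k =>
    (measurable_digit.comp (hT.iterate k)) (MeasurableSpace.measurableSet_top)

theorem iUnion_cylinder (n : ℕ) : ⋃ i : Fin n → ℕ+, cylinder i = Set.univ :=
  Set.eq_univ_of_forall fun x => Set.mem_iUnion.2 ⟨fun k => digit (T^[k] x), fun _ => rfl⟩

theorem pairwise_disjoint_cylinder (n : ℕ) :
    Pairwise (Function.onFun Disjoint fun i : Fin n → ℕ+ => cylinder i) := fun _ _ hij =>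
  Set.disjoint_left.2 fun _ hx hy => hij (funext fun k => (hx k).symm.trans (hy k))

/-- A measure whose cylinders are dominated by the weights of a normalised potential is dominated
by the corresponding transfer operator. -/
theorem lintegral_le_iterate {φ : X → ℝ} (hφ : Normalized φ) (hT : Measurable T) {μ : Measure X}
    {K : ℝ} (hK : 0 ≤ K) {n : ℕ} {y : X} (hμ : ∀ i : Fin n → ℕ+, μ (cylinder i) ≤
      ENNReal.ofReal (K * Real.exp (birkhoff φ n (wordBranch n i y))))
    {F G : X → ℝ} {B : ℝ} (hG : ∀ x, |G x| ≤ B) (hG0 : ∀ x, 0 ≤ G x)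
    (hFG : ∀ i : Fin n → ℕ+, ∀ x ∈ cylinder i, F x ≤ G (wordBranch n i y)) :
    ∫⁻ x, ENNReal.ofReal (F x) ∂μ ≤ ENNReal.ofReal (K * (transfer φ)^[n] G y) := by
  have hs := (hφ.hasSum_iterate hG n y).mul_left K
  rw [← setLIntegral_univ, ← iUnion_cylinder n,
    lintegral_iUnion (measurableSet_cylinder hT) (pairwise_disjoint_cylinder n), ← hs.tsum_eq,
    ENNReal.ofReal_tsum_of_nonneg
      (fun i => mul_nonneg hK (mul_nonneg (Real.exp_pos _).le (hG0 _))) hs.summable]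
  refine ENNReal.tsum_le_tsum fun i => ?_
  calc ∫⁻ x in cylinder i, ENNReal.ofReal (F x) ∂μ
      ≤ ∫⁻ _ in cylinder i, ENNReal.ofReal (G (wordBranch n i y)) ∂μ :=
        setLIntegral_mono measurable_const fun x hx => ENNReal.ofReal_le_ofReal (hFG i x hx)
    _ = ENNReal.ofReal (G (wordBranch n i y)) * μ (cylinder i) := setLIntegral_const _ _
    _ ≤ ENNReal.ofReal (G (wordBranch n i y)) *
        ENNReal.ofReal (K * Real.exp (birkhoff φ n (wordBranch n i y))) := by gcongr; exact hμ i
    _ = _ := by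
        rw [← ENNReal.ofReal_mul (hG0 _)]
        congr 1
        ring

theorem integral_birkhoff {μ : Measure X} (hT : MeasurePreserving T μ μ) {f : X → ℝ}
    (hf : Integrable f μ) (n : ℕ) : ∫ x, birkhoff f n x ∂μ = n * ∫ x, f x ∂μ := by
  have hi : ∀ k, Integrable (fun x => f (T^[k] x)) μ := fun k =>
    (hT.iterate k).integrable_comp_of_integrable hf
  have hk : ∀ k, ∫ x, f (T^[k] x) ∂μ = ∫ x, f x ∂μ := fun k => by
    have h := (hT.iterate k).map_eq
    rw [← integral_map (hT.iterate k).measurable.aemeasurable (by rw [h]; exact hf.1), h]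
  simp only [birkhoff]
  rw [integral_finsetSum _ fun k _ => hi k]
  simp [hk]

/-- The invariant measure integrates to zero every Lipschitz function whose iterates under the
transfer operator decay. -/
theorem integral_eq_zero_of_iterate_le {φ : X → ℝ} (hφ : Normalized φ) {μ : Measure X}
    [IsProbabilityMeasure μ] (hT : MeasurePreserving T μ μ) {K : ℝ} (hK : 0 ≤ K)
    (hμ : ∀ n, 1 ≤ n → ∀ (i : Fin n → ℕ+) (y : X), μ (cylinder i) ≤
      ENNReal.ofReal (K * Real.exp (birkhoff φ n (wordBranch n i y))))
    {f : X → ℝ} {A B C ρ : ℝ} (hA0 : 0 ≤ A) (hA : ∀ x y, |f x - f y| ≤ A * |x.1 - y.1|)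
    (hf : ∀ x, |f x| ≤ B) (hρ0 : 0 ≤ ρ) (hρ1 : ρ < 1)
    (hC : ∀ n x, |(transfer φ)^[n] f x| ≤ ρ ^ n * C) : ∫ x, f x ∂μ = 0 := by
  have hcont : Continuous f := (LipschitzWith.of_dist_le_mul (K := ⟨A, hA0⟩) hA).continuous
  have hint : Integrable f μ :=
    Integrable.of_bound hcont.measurable.aestronglyMeasurable B (ae_of_all _ hf)
  set y := Classical.arbitrary X
  set D := K * (2 * (B ^ 2 + 2 * (B * (C / (1 - ρ)))) + 2 * (2 * A) ^ 2)
  have key : ∀ n : ℕ, 1 ≤ n → n * (∫ x, f x ∂μ) ^ 2 ≤ D := by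
    intro n hn
    have hn' : (1 : ℝ) ≤ n := by exact_mod_cast hn
    have hmeas : Measurable (birkhoff f n) := by
      unfold birkhoff
      exact Finset.measurable_fun_sum _ fun k _ => hcont.measurable.comp (hT.measurable.iterate k)
    have hS := abs_birkhoff_le hf n
    have hSi : Integrable (birkhoff f n) μ :=
      Integrable.of_bound hmeas.aestronglyMeasurable _ (ae_of_all _ hS)
    have hsq : ∀ x, |birkhoff f n x ^ 2| ≤ n * B * (n * B) := fun x => by
      rw [sq]
      exact abs_mul_le_mul (hS x) (hS x)
    have hSi2 : Integrable (fun x => birkhoff f n x ^ 2) μ :=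
      Integrable.of_bound (hmeas.pow_const 2).aestronglyMeasurable _ (ae_of_all _ hsq)
    have hG : ∀ x, |2 * birkhoff f n x ^ 2 + 2 * (2 * A) ^ 2| ≤
        2 * (n * B * (n * B)) + 2 * (2 * A) ^ 2 := fun x => by
      rw [abs_of_nonneg (by positivity)]
      linarith [(abs_le.1 (hsq x)).2]
    have hl := lintegral_le_iterate hφ hT.measurable hK (hμ n hn · y)
      (F := fun x => birkhoff f n x ^ 2) hG (fun x => by positivity) fun i x hx => by
        have h := abs_le.1 (abs_birkhoff_sub_le hA0 hA n i hx (wordBranch_mem_cylinder n i y))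
        have h' : (birkhoff f n x - birkhoff f n (wordBranch n i y)) ^ 2 ≤ (2 * A) ^ 2 :=
          sq_le_sq' h.1 h.2
        nlinarith [sq_nonneg (birkhoff f n x - 2 * birkhoff f n (wordBranch n i y))]
    -- On a cylinder, `S_n f` differs by at most `2 * A` from its value at the representative point,
    -- whence `(S_n f)² ≤ 2 (S_n f)² + 2 (2 A)²` with the right side taken there.
    rw [← ofReal_integral_eq_lintegral_ofReal hSi2 (ae_of_all _ fun x => sq_nonneg _),
      hφ.iterate_add (B := 2 * (n * B * (n * B))) (fun x => by
        rw [abs_mul, abs_two]; linarith [hsq x]) (fun _ => le_rfl),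
      Normalized.iterate_const_mul, hφ.iterate_const] at hl
    beta_reduce at hl
    have hQ0 : 0 ≤ (transfer φ)^[n] (fun x => birkhoff f n x ^ 2) y := by
      have := hφ.iterate_mono (w := fun _ => 0) (fun _ => le_rfl) hsq (fun x => sq_nonneg _) n y
      rwa [hφ.iterate_const] at this
    have hl' := (ENNReal.ofReal_le_ofReal_iff (by positivity)).1 hl
    have hQ := hφ.iterate_birkhoff_sq_le hf hρ0 hρ1 hC n y
    have hint2 : ∫ x, birkhoff f n x ^ 2 ∂μ ≤ n * D := by
      refine hl'.trans ?_
      have h1 : 2 * (2 * A) ^ 2 ≤ n * (2 * (2 * A) ^ 2) :=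
        le_mul_of_one_le_left (by positivity) hn'
      calc _ ≤ K * (2 * (n * (B ^ 2 + 2 * (B * (C / (1 - ρ))))) + n * (2 * (2 * A) ^ 2)) := by
            gcongr
        _ = _ := by ring
    set I := ∫ x, f x ∂μ
    have hvar : 0 ≤ ∫ x, (birkhoff f n x - n * I) ^ 2 ∂μ := integral_nonneg fun x => sq_nonneg _
    have hexp : ∫ x, (birkhoff f n x - n * I) ^ 2 ∂μ =
        ∫ x, birkhoff f n x ^ 2 ∂μ - (n * I) ^ 2 := by
      have : ∀ x, (birkhoff f n x - n * I) ^ 2 =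
          birkhoff f n x ^ 2 - (2 * (n * I)) * birkhoff f n x + (n * I) ^ 2 := fun x => by ring
      have hi : Integrable (fun x => birkhoff f n x ^ 2 - 2 * (n * I) * birkhoff f n x) μ :=
        hSi2.sub (hSi.const_mul _)
      simp only [this]
      rw [integral_add hi (integrable_const _), integral_sub hSi2 (hSi.const_mul _),
        integral_const_mul, integral_birkhoff hT hint]
      simp
      ring
    have : (n : ℝ) * (n * I ^ 2) ≤ n * D := by nlinarith
    exact le_of_mul_le_mul_left this (by linarith)
  by_contra hne
  have hpos : 0 < (∫ x, f x ∂μ) ^ 2 := by positivity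
  obtain ⟨n, hn⟩ := exists_nat_gt (D / (∫ x, f x ∂μ) ^ 2)
  rw [div_lt_iff₀ hpos] at hn
  have h1 := key (n + 1) (by omega)
  push_cast at h1
  linarith

/-! ### The normalised potential of a positive fixed point -/

/-- The potential `g + log h - log h ∘ T`. -/
def normPotential (g h : X → ℝ) (x : X) : ℝ :=
  g x + Real.log (h x) - Real.log (h (T x))

theorem exp_normPotential_branch {g h : X → ℝ} (hpos : ∀ x, 0 < h x) (a : ℕ+) (x : X) :
    Real.exp (normPotential g h (branch a x)) =
      (h x)⁻¹ * (Real.exp (g (branch a x)) * h (branch a x)) := by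
  rw [normPotential, T_branch, Real.exp_sub, Real.exp_add, Real.exp_log (hpos _),
    Real.exp_log (hpos _), div_eq_inv_mul]

theorem normTransfer_eq {g h : X → ℝ} (hpos : ∀ x, 0 < h x) :
    normTransfer g h = transfer (normPotential g h) := by
  funext w x
  simp only [normTransfer, transfer_eq_tsum, ← tsum_mul_left, exp_normPotential_branch hpos]
  exact tsum_congr fun a => by ring

theorem birkhoff_normPotential (g h : X → ℝ) (n : ℕ) (x : X) :
    birkhoff (normPotential g h) n x =
      birkhoff g n x + Real.log (h x) - Real.log (h (T^[n] x)) := by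
  induction n generalizing x with
  | zero => simp [birkhoff]
  | succ n ih =>
    rw [birkhoff_succ, birkhoff_succ, ih, normPotential, Function.iterate_succ_apply]
    ring

theorem birkhoff_normPotential_wordBranch (g h : X → ℝ) (n : ℕ) (i : Fin n → ℕ+) (x : X) :
    birkhoff (normPotential g h) n (wordBranch n i x) =
      birkhoff g n (wordBranch n i x) + Real.log (h (wordBranch n i x)) - Real.log (h x) := by
  rw [birkhoff_normPotential, iterate_T_wordBranch]

namespace IsPositiveFixedPoint

variable {g h : X → ℝ}

theorem normalized (hh : IsPositiveFixedPoint g h) : Normalized (normPotential g h) := by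
  intro x
  have hx : ∑' a, Real.exp (g (branch a x)) * h (branch a x) = h x := by
    rw [← transfer_eq_tsum, hh.2.2]
  have hs : Summable fun a => Real.exp (g (branch a x)) * h (branch a x) := by
    -- A divergent series would have `tsum` equal to `0`, contradicting `h x > 0`.
    by_contra hns
    rw [tsum_eq_zero_of_not_summable hns] at hx
    exact (hh.2.1 x).ne hx
  have h1 := hs.hasSum.mul_left (h x)⁻¹
  rw [hx, inv_mul_cancel₀ (hh.2.1 x).ne'] at h1
  simpa only [exp_normPotential_branch hh.2.1] using h1

theorem hasSum_words (hh : IsPositiveFixedPoint g h) (n : ℕ) (x : X) :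
    HasSum (fun i : Fin n → ℕ+ =>
      Real.exp (birkhoff g n (wordBranch n i x)) * h (wordBranch n i x)) (h x) := by
  have h1 := (hh.normalized.hasSum_iterate (w := fun _ => 1) (fun _ => le_rfl) n x).mul_left (h x)
  rw [hh.normalized.iterate_const, mul_one] at h1
  have hterm : ∀ i : Fin n → ℕ+,
      h x * (Real.exp (birkhoff (normPotential g h) n (wordBranch n i x)) * 1) =
        Real.exp (birkhoff g n (wordBranch n i x)) * h (wordBranch n i x) := fun i => by
    have := (hh.2.1 x).ne'
    rw [birkhoff_normPotential_wordBranch, Real.exp_sub, Real.exp_add, Real.exp_log (hh.2.1 _),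
      Real.exp_log (hh.2.1 _)]
    field_simp
  simpa only [hterm] using h1

/-- By local Hölder continuity `h` is at least `h x₀ / 2` on a deep cylinder around `x₀`. Every `x`
has a preimage there, and by bounded distortion that single term of the fixed-point series has a
weight bounded below uniformly in `x`. -/
theorem exists_pos_le (hh : IsPositiveFixedPoint g h) (hg : BoundedDistortion 2 g) :
    ∃ δ > 0, ∀ x, δ ≤ h x := by
  obtain ⟨C, hC, θ, hθ0, hθ1, hH⟩ := hh.1.1
  set x₀ := Classical.arbitrary X
  have hx₀ := hh.2.1 x₀
  obtain ⟨n, hn⟩ := exists_pow_lt_of_lt_one (show 0 < h x₀ / (2 * C) by positivity) hθ1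
  set i : Fin (n + 1) → ℕ+ := fun k => digit (T^[k] x₀)
  have hi : x₀ ∈ cylinder i := fun _ => rfl
  refine ⟨Real.exp (birkhoff g (n + 1) (wordBranch (n + 1) i x₀) - 4) * (h x₀ / 2), by positivity,
    fun x => ?_⟩
  refine le_trans ?_ (le_hasSum (hh.hasSum_words (n + 1) x) i fun j _ =>
    mul_nonneg (Real.exp_pos _).le (hh.2.1 _).le)
  have h1 := birkhoff_wordBranch_le zero_le_two hg (n + 1) i x₀ x
  have h2 := (logDist_le_log_two x₀ x).trans (by linarith [Real.log_two_lt_d9] : _ ≤ (1 : ℝ))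
  have h3 := (abs_le.1 (hH (n + 1) (by omega) i x₀ hi _ (wordBranch_mem_cylinder _ i x))).2
  have h4 : C * θ ^ (n + 1) ≤ h x₀ / 2 := by
    have h5 : θ ^ (n + 1) ≤ θ ^ n := pow_le_pow_of_le_one hθ0.le hθ1.le n.le_succ
    have h6 := mul_lt_mul_of_pos_left (h5.trans_lt hn) hC
    refine h6.le.trans_eq ?_
    field_simp
  exact mul_le_mul (Real.exp_le_exp.2 (by linarith)) (by linarith) (by positivity)
    (Real.exp_pos _).le

/-- Word sums at `x` and `y` are compared term by term. The Hölder data of `h` and its lower bound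
`δ` enter only through `C * θ ^ (n + 1) / δ`, which vanishes as `n → ∞`; the constant `4` is twice
the distortion of `g`. -/
theorem log_le (hh : IsPositiveFixedPoint g h) (hg : BoundedDistortion 2 g) (x y : X) :
    Real.log (h x) ≤ Real.log (h y) + 4 * logDist x y := by
  obtain ⟨δ, hδ, hδh⟩ := hh.exists_pos_le hg
  obtain ⟨C, hC, θ, hθ0, hθ1, hH⟩ := hh.1.1
  have key : ∀ n : ℕ, h x ≤
      Real.exp (4 * logDist x y) * (1 + C * θ ^ (n + 1) / δ) * h y := by
    intro n
    refine hasSum_le (fun i => ?_) (hh.hasSum_words (n + 1) x)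
      ((hh.hasSum_words (n + 1) y).mul_left _)
    have h1 : Real.exp (birkhoff g (n + 1) (wordBranch (n + 1) i x)) ≤
        Real.exp (4 * logDist x y) * Real.exp (birkhoff g (n + 1) (wordBranch (n + 1) i y)) := by
      rw [← Real.exp_add]
      exact Real.exp_le_exp.2 (by linarith [birkhoff_wordBranch_le zero_le_two hg (n + 1) i x y])
    have h2 : h (wordBranch (n + 1) i x) ≤
        (1 + C * θ ^ (n + 1) / δ) * h (wordBranch (n + 1) i y) := by
      have h3 := (abs_le.1 (hH (n + 1) (by omega) i _ (wordBranch_mem_cylinder _ i x) _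
        (wordBranch_mem_cylinder _ i y))).2
      have h4 : C * θ ^ (n + 1) ≤ C * θ ^ (n + 1) / δ * h (wordBranch (n + 1) i y) := by
        rw [div_mul_eq_mul_div, le_div_iff₀ hδ]
        exact mul_le_mul_of_nonneg_left (hδh _) (by positivity)
      linarith
    calc _ ≤ (Real.exp (4 * logDist x y) *
          Real.exp (birkhoff g (n + 1) (wordBranch (n + 1) i y))) *
          ((1 + C * θ ^ (n + 1) / δ) * h (wordBranch (n + 1) i y)) :=
          mul_le_mul h1 h2 (hh.2.1 _).le (by positivity)
      _ = _ := by ring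
  have hlim : Tendsto (fun n : ℕ =>
      Real.exp (4 * logDist x y) * (1 + C * θ ^ (n + 1) / δ) * h y) atTop
      (𝓝 (Real.exp (4 * logDist x y) * (1 + C * 0 / δ) * h y)) :=
    ((((((tendsto_pow_atTop_nhds_zero_of_lt_one hθ0.le hθ1).comp
      (tendsto_add_atTop_nat 1)).const_mul C).div_const δ).const_add 1).const_mul _).mul_const _
  have hle := ge_of_tendsto' hlim key
  rw [mul_zero, zero_div, add_zero, mul_one] at hle
  have := Real.log_le_log (hh.2.1 x) hle
  rw [Real.log_mul (Real.exp_pos _).ne' (hh.2.1 y).ne', Real.log_exp] at this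
  linarith

/-- The sum `2 + 4 / 2 + 4`: from `g`, from `log h` at the contracted points, and from `log h` at
the base points. -/
theorem boundedDistortion (hh : IsPositiveFixedPoint g h) (hg : BoundedDistortion 2 g) :
    BoundedDistortion 8 (normPotential g h) := by
  intro a x y
  simp only [normPotential, T_branch]
  have h1 := hg a x y
  have h2 := hh.log_le hg (branch a x) (branch a y)
  have h3 := logDist_branch_le a x y
  have h4 := hh.log_le hg y x
  rw [logDist_comm] at h4
  linarith

/-- Gibbs measures give each cylinder at most a multiple of its weight under the normalised
potential. -/
theorem measure_cylinder_le (hh : IsPositiveFixedPoint g h) (hg : BoundedDistortion 2 g)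
    (hT : Measurable T) {μ : Measure X} [IsProbabilityMeasure μ] (hμ : IsGibbs g μ) :
    ∃ K : ℝ, 0 ≤ K ∧ ∀ n, 1 ≤ n → ∀ (i : Fin n → ℕ+) (y : X), μ (cylinder i) ≤
      ENNReal.ofReal (K * Real.exp (birkhoff (normPotential g h) n (wordBranch n i y))) := by
  obtain ⟨C, hC, P, hP⟩ := hμ
  have hlog : ∀ x y, Real.log (h x) ≤ Real.log (h y) + 4 := fun x y => by
    linarith [hh.log_le hg x y, logDist_le_log_two x y, Real.log_two_lt_d9]
  -- The lower Gibbs bounds add up to at most `1`, while the normalised weights add up to exactly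
  -- `1`; this bounds `exp (-(n * P))`. The `4` bounds the oscillation of `log h`.
  have hpress : ∀ n : ℕ, 1 ≤ n → Real.exp (-(n * P)) ≤ C * Real.exp 4 := by
    intro n hn
    set y := Classical.arbitrary X
    have hs := (hh.normalized.hasSum_iterate (w := fun _ => 1) (fun _ => le_rfl) n y).mul_left
      (C⁻¹ * Real.exp (-4) * Real.exp (-(n * P)))
    rw [hh.normalized.iterate_const, mul_one] at hs
    have hle : ENNReal.ofReal (C⁻¹ * Real.exp (-4) * Real.exp (-(n * P))) ≤ 1 := by
      calc _ = ∑' i : Fin n → ℕ+, ENNReal.ofReal (C⁻¹ * Real.exp (-4) * Real.exp (-(n * P)) *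
            (Real.exp (birkhoff (normPotential g h) n (wordBranch n i y)) * 1)) := by
            rw [← ENNReal.ofReal_tsum_of_nonneg (fun i => by positivity) hs.summable, hs.tsum_eq]
        _ ≤ ∑' i : Fin n → ℕ+, μ (cylinder i) := by
            refine ENNReal.tsum_le_tsum fun i => le_trans (ENNReal.ofReal_le_ofReal ?_)
              (hP n hn i _ (wordBranch_mem_cylinder n i y)).1
            rw [mul_one, mul_assoc, mul_assoc, ← Real.exp_add, ← Real.exp_add]
            refine mul_le_mul_of_nonneg_left (Real.exp_le_exp.2 ?_) (by positivity)
            rw [birkhoff_normPotential_wordBranch]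
            linarith [hlog (wordBranch n i y) y]
        _ = 1 := by
            rw [← measure_iUnion (pairwise_disjoint_cylinder n) (measurableSet_cylinder hT),
              iUnion_cylinder, measure_univ]
    rw [ENNReal.ofReal_le_one, mul_assoc, inv_mul_le_iff₀ hC, mul_one, Real.exp_neg 4,
      inv_mul_le_iff₀ (Real.exp_pos 4)] at hle
    linarith
  refine ⟨C * (C * Real.exp 4) * Real.exp 4, by positivity, fun n hn i y => ?_⟩
  refine (hP n hn i _ (wordBranch_mem_cylinder n i y)).2.trans (ENNReal.ofReal_le_ofReal ?_)
  rw [mul_assoc, mul_assoc C, sub_eq_neg_add, Real.exp_add, ← Real.exp_add 4]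
  refine mul_le_mul_of_nonneg_left (mul_le_mul (hpress n hn) (Real.exp_le_exp.2 ?_)
    (Real.exp_pos _).le (by positivity)) hC.le
  rw [birkhoff_normPotential_wordBranch]
  linarith [hlog y (wordBranch n i y)]

end IsPositiveFixedPoint

/-! ### The Lipschitz norm -/

theorem lipNorm_le {f : X → ℝ} {A B : ℝ} (hA : ∀ x y, |f x - f y| ≤ A * |x.1 - y.1|)
    (hB : ∀ x, |f x| ≤ B) : lipNorm f ≤ ENNReal.ofReal A + ENNReal.ofReal B := by
  refine add_le_add (iSup_le fun x => iSup_le fun y => iSup_le fun hxy =>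
    ENNReal.ofReal_le_ofReal ?_) (iSup_le fun x => ENNReal.ofReal_le_ofReal (hB x))
  rw [div_le_iff₀ (abs_pos.2 (sub_ne_zero.2 fun h => hxy (Subtype.ext h)))]
  exact hA x y

theorem exists_lipNorm_eq {f : X → ℝ} (hf : lipNorm f < ∞) :
    ∃ A B : ℝ, 0 ≤ A ∧ 0 ≤ B ∧ (∀ x y, |f x - f y| ≤ A * |x.1 - y.1|) ∧ (∀ x, |f x| ≤ B) ∧
      lipNorm f = ENNReal.ofReal (A + B) := by
  rw [lipNorm, ENNReal.add_lt_top] at hf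
  refine ⟨(⨆ (x : X) (y : X) (_ : x ≠ y), ENNReal.ofReal (|f x - f y| / |x.1 - y.1|)).toReal,
    (⨆ x : X, ENNReal.ofReal |f x|).toReal,
    ENNReal.toReal_nonneg, ENNReal.toReal_nonneg, fun x y => ?_, fun x => ?_, ?_⟩
  rotate_left 2
  · rw [lipNorm, ENNReal.ofReal_add ENNReal.toReal_nonneg ENNReal.toReal_nonneg,
      ENNReal.ofReal_toReal hf.1.ne, ENNReal.ofReal_toReal hf.2.ne]
  · rcases eq_or_ne x y with rfl | hxy
    · simp
    · rw [← div_le_iff₀ (abs_pos.2 (sub_ne_zero.2 fun h => hxy (Subtype.ext h))),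
        ← ENNReal.ofReal_le_iff_le_toReal hf.1.ne]
      exact le_iSup_of_le x (le_iSup_of_le y (le_iSup_of_le hxy le_rfl))
  · rw [← ENNReal.ofReal_le_iff_le_toReal hf.2.ne]
    exact le_iSup (fun x => ENNReal.ofReal |f x|) x

/-- The spectral gap for a potential with bounded distortion. -/
theorem lipNorm_iterate_normTransfer_le {g h : X → ℝ}
    (hg : BoundedDistortion 2 g)
    (hh : IsPositiveFixedPoint g h) {μ : Measure X} [IsProbabilityMeasure μ]
    (hT : MeasurePreserving T μ μ) (hμ : IsGibbs g μ) {f : X → ℝ} (hf : lipNorm f < ∞)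
    (hf0 : ∫ x, f x ∂μ = 0) (n : ℕ) :
    lipNorm ((normTransfer g h)^[n] f) ≤
      ENNReal.ofReal (2 ^ 39 * (1 - 1 / 2 ^ 26) ^ n) * lipNorm f := by
  have hφ := hh.normalized
  have hd := hh.boundedDistortion hg
  obtain ⟨A, B, hA0, hB0, hA, hB, hAB⟩ := exists_lipNorm_eq hf
  obtain ⟨K, hK, hKμ⟩ := hh.measure_cylinder_le hg hT.measurable hμ
  obtain ⟨c, hc⟩ := exists_limit_iterate hφ hd hB hA hA0
  have hcont : Continuous f := (LipschitzWith.of_dist_le_mul (K := ⟨A, hA0⟩) hA).continuous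
  have hint : Integrable f μ :=
    Integrable.of_bound hcont.measurable.aestronglyMeasurable B (ae_of_all _ hB)
  -- The iterates of `f - c` decay, so its integral vanishes; so does that of `f`.
  have hc0 : c = 0 := by
    have h1 := integral_eq_zero_of_iterate_le hφ hT hK hKμ (f := fun x => f x + -c)
      (B := B + |c|) (C := 2 * (A + B)) hA0
      (fun x y => by rw [add_sub_add_right_eq_sub]; exact hA x y)
      (fun x => (abs_add_le _ _).trans (by rw [abs_neg]; linarith [hB x]))
      (show (0 : ℝ) ≤ 1 - 1 / 2 ^ 26 by norm_num) (by norm_num) (fun n x => by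
        rw [hφ.iterate_add hB (fun _ => le_rfl), hφ.iterate_const]
        beta_reduce
        rw [← sub_eq_add_neg]
        exact hc n x)
    rw [integral_add hint (integrable_const _), hf0] at h1
    simpa using h1
  have hρ : (0 : ℝ) ≤ (1 - 1 / 2 ^ 26) ^ n := pow_nonneg (by norm_num) n
  have hlip := (iterate_sub_le hφ hd hB hA hA0 n).2
  rw [normTransfer_eq hh.2.1, hAB, ← ENNReal.ofReal_mul (by positivity)]
  refine (lipNorm_le (A := 2 ^ 38 * (1 - 1 / 2 ^ 26) ^ n * (A + B))
    (B := (1 - 1 / 2 ^ 26) ^ n * (2 * (A + B))) (fun x y => ?_) fun x => ?_).trans ?_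
  · have h1 := hlip y x
    rw [abs_sub_comm y.1] at h1
    exact abs_le.2 ⟨by linarith, hlip x y⟩
  · simpa [hc0] using hc n x
  · rw [← ENNReal.ofReal_add (by positivity) (by positivity)]
    refine ENNReal.ofReal_le_ofReal ?_
    have : 0 ≤ (1 - 1 / 2 ^ 26) ^ n * (A + B) := by positivity
    linarith

end GaussGap

end

open GaussGap in
theorem lemma4p13 (ε : ℝ) (hε : 0 < ε) :
    ∃ c₄ > (0 : ℝ), ∃ ρ : ℝ, 0 < ρ ∧ ρ < 1 ∧
      ∀ p : PMF ℕ+, Admissible ε p →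
      ∀ t ∈ Set.Icc (0 : ℝ) 1, ∀ b : ℝ, IsBeta p t b →
      ∀ h : X → ℝ, IsPositiveFixedPoint (potential p t b) h →
      ∀ μ : Measure X, IsProbabilityMeasure μ → MeasurePreserving T μ μ →
        IsGibbs (potential p t b) μ →
      ∀ f : X → ℝ, lipNorm f < ∞ → ∫ x, f x ∂μ = 0 →
      ∀ n : ℕ, lipNorm ((normTransfer (potential p t b) h)^[n] f) ≤
        ENNReal.ofReal (c₄ * ρ ^ n) * lipNorm f := by
  refine ⟨2 ^ 39, by norm_num, 1 - 1 / 2 ^ 26, by norm_num, by norm_num, ?_⟩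
  intro p _ t _ b hb h hh μ _ hT hμ f hf hf0 n
  exact lipNorm_iterate_normTransfer_le (boundedDistortion_potential p t b hb.1) hh hT hμ hf hf0 n
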